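/- For a real number $\lambda>1$ let $\Lambda=\{\pm\lambda^n : n\in\mathbb Z\}$. Let $F$ be the real vector space of absolutely summable functions $f:\Lambda\to\mathbb C$ with $f(-k)=\overline{f(k)}$; put $(f,g)=\sum_{k\in\Lambda}f(k)\overline{g(k)}$ and $\partial f(k)=ik f(k)$. For $p\in\Lambda$ let $\delta_p:\Lambda\to\mathbb C$ be the function equal to $1$ at $p$ and $0$ elsewhere. Consider the following three cases. (i) $\lambda=2$. (ii) $\lambda=\sigma=\dfrac{\sqrt[3]{9+\sqrt{69}}+\sqrt[3]{9-\sqrt{69}}}{\sqrt[3]{18}}$, the plastic number; it satisfies $1=\sigma^3-\sigma=\sigma^5-\sigma^4$. (iii) $1=\lambda^b-\lambda^a$ with coprime integers $0\le a<b\le 62$ and $(a,b)\notin\{(0,1),(1,3),(4,5)\}$. For integers $a,b$ define, for $f,g:\Lambda\to\mathbb C$ and $k\in\Lambda$, $$S_{a,b}(f,g)(k)=\sum_{j=1}^{6}f(p_jk)\,g(q_jk),$$ where $(p_j,q_j)$ runs over the six pairs $(\lambda^b,-\lambda^a)$, $(-\lambda^a,\lambda^b)$, $(\lambda^{b-a},-\lambda^{-a})$,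 $(-\lambda^{-a},\lambda^{b-a})$, $(\lambda^{-b},\lambda^{a-b})$, $(\lambda^{a-b},\lambda^{-b})$. (A) In each of the cases (i)--(iii), let $\ast:F\times F\to F$ be a binary operation, not identically zero, such that for all $f,g,h\in F$ and $\gamma\in\mathbb R$: $(f+\gamma g)\ast h=f\ast h+\gamma(g\ast h)$; $f\ast g=g\ast f$; $(f\ast g,h)=(f,g\ast h)$; $\partial(f\ast g)=\partial f\ast g+f\ast\partial g$ whenever $\partial f,\partial g\in F$; $(f\ast g)(\lambda\,\cdot)=f(\lambda\,\cdot)\ast g(\lambda\,\cdot)$; and $(f\ast g)(-\,\cdot)=f(-\,\cdot)\ast g(-\,\cdot)$. Then $\ast$ is not associative: there are $f,g,h\in F$ with $(f\ast g)\ast h\ne f\ast(g\ast h)$. (B) The same holds for the following explicit products, that is, each of them is non-associative on $F$: in case (i), $(f\ast g)(k)=c\,[f(2k)g(-k)+f(-k)g(2k)+f(k/2)g(k/2)]$ with real $c\neq0$; in case (ii), $f\ast g=c_1S_{1,3}(f,g)+c_2S_{4,5}(f,g)$ with real $(c_1,c_2)\ne(0,0)$; in case (iii), $f\ast g=c\,S_{a,b}(f,g)$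 with real $c\ne0$. (C) For the explicit products of (B), applied to arbitrary functions $\Lambda\to\mathbb C$, put $(a,b)=(0,1)$ in case (i); $(a,b)=(1,3)$ if $c_1\neq0$, and likewise $(a,b)=(4,5)$ if $c_2\ne0$, in case (ii); and the given $(a,b)$ in case (iii). Then $1+\lambda^b\notin\Lambda$, and with $p=\lambda^{2b}$, $q=-\lambda^{a+b}$, $r=-\lambda^a$, $$(\delta_p\ast\delta_q)\ast\delta_r\neq\delta_p\ast(\delta_q\ast\delta_r).$$ -/

import Mathlib

noncomputable section

/-- The logarithmic lattice `{± lam ^ n : n ∈ ℤ}` with spacing factor `lam`. -/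
def logLattice (lam : ℝ) : Set ℝ := {k | ∃ n : ℤ, k = lam ^ n ∨ k = -lam ^ n}

namespace LogLattice

theorem neg_mem {lam k : ℝ} (hk : k ∈ logLattice lam) : -k ∈ logLattice lam := by
  obtain ⟨n, h | h⟩ := hk
  · exact ⟨n, Or.inr (by rw [h])⟩
  · exact ⟨n, Or.inl (by rw [h, neg_neg])⟩

theorem zpow_mul_zpow_mem (lam : ℝ) (m n : ℤ) : lam ^ m * lam ^ n ∈ logLattice lam := by
  by_cases h0 : lam = 0
  · by_cases hm : m = 0
    · exact ⟨n, Or.inl (by simp [hm])⟩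
    · exact ⟨m, Or.inl (by simp [h0, zero_zpow m hm])⟩
  · exact ⟨m + n, Or.inl (zpow_add₀ h0 m n).symm⟩

theorem mul_mem {lam k l : ℝ} (hk : k ∈ logLattice lam) (hl : l ∈ logLattice lam) :
    k * l ∈ logLattice lam := by
  obtain ⟨m, h | h⟩ := hk <;> obtain ⟨n, h' | h'⟩ := hl <;> subst h <;> subst h'
  · exact zpow_mul_zpow_mem lam m n
  · rw [mul_neg]
    exact neg_mem (zpow_mul_zpow_mem lam m n)
  · rw [neg_mul]
    exact neg_mem (zpow_mul_zpow_mem lam m n)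
  · rw [neg_mul_neg]
    exact zpow_mul_zpow_mem lam m n

instance (lam : ℝ) : Neg (logLattice lam) := ⟨fun k => ⟨-k.1, neg_mem k.2⟩⟩

instance (lam : ℝ) : Mul (logLattice lam) := ⟨fun k l => ⟨k.1 * l.1, mul_mem k.2 l.2⟩⟩

/-- The lattice point `lam ^ n`. -/
def pt (lam : ℝ) (n : ℤ) : logLattice lam := ⟨lam ^ n, n, Or.inl rfl⟩

/-- The function with value `1` at `p` and `0` at all other lattice points. -/
def delta {lam : ℝ} (p : logLattice lam) : logLattice lam → ℂ :=
  open Classical in fun k => if k = p then 1 else 0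

/-- The real vector space of absolutely summable functions on the lattice that satisfy the
reality condition `f (-k) = conj (f k)`. -/
def latticeFn (lam : ℝ) : Submodule ℝ (logLattice lam → ℂ) where
  carrier := {f | (∀ k, f (-k) = starRingEnd ℂ (f k)) ∧ Summable fun k => ‖f k‖}
  zero_mem' := by
    exact ⟨fun k => by simp, by simp⟩
  add_mem' := by
    rintro f g ⟨hf, hf'⟩ ⟨hg, hg'⟩
    exact ⟨fun k => by simp [hf k, hg k],
      (hf'.add hg').of_nonneg_of_le (fun _ => norm_nonneg _) fun k => norm_add_le _ _⟩
  smul_mem' := by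
    rintro c f ⟨hf, hf'⟩
    refine ⟨fun k => by simp [hf k], ?_⟩
    simpa [norm_smul] using hf'.mul_left |c|

/-- The derivative `∂ f (k) = i k f (k)`. -/
def partialD {lam : ℝ} (f : logLattice lam → ℂ) : logLattice lam → ℂ :=
  fun k => Complex.I * ((k : ℝ) : ℂ) * f k

/-- The rescaling `k ↦ f (lam k)`. -/
def rescale {lam : ℝ} (f : logLattice lam → ℂ) : logLattice lam → ℂ :=
  fun k => f (pt lam 1 * k)

/-- The reflection `k ↦ f (-k)`; together with the identity it gives all symmetries `k ↦ ± k` of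
the one-dimensional lattice. -/
def reflect {lam : ℝ} (f : logLattice lam → ℂ) : logLattice lam → ℂ :=
  fun k => f (-k)

/-- The inner product `∑ₖ f (k) conj (g (k))`. -/
def innerProd {lam : ℝ} (f g : logLattice lam → ℂ) : ℂ :=
  ∑' k, f k * starRingEnd ℂ (g k)

/-- A product on the one-dimensional logarithmic lattice with scaling invariance and parity.
The derivative of a summable function need not be summable, so the Leibniz rule is required for all
`f`, `g` whose derivatives `f'`, `g'` are again in the function space. -/
structure IsSymmetricProduct {lam : ℝ}
    (op : latticeFn lam → latticeFn lam → latticeFn lam) : Prop where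
  reality : ∀ f g : latticeFn lam, ∀ k : logLattice lam,
    (op f g).1 (-k) = starRingEnd ℂ ((op f g).1 k)
  bilinear : ∀ (f g h : latticeFn lam) (γ : ℝ), op (f + γ • g) h = op f h + γ • op g h
  comm : ∀ f g : latticeFn lam, op f g = op g f
  assoc_avg : ∀ f g h : latticeFn lam, innerProd (op f g).1 h.1 = innerProd f.1 (op g h).1
  leibniz : ∀ f g f' g' : latticeFn lam, f'.1 = partialD f.1 → g'.1 = partialD g.1 →
    partialD (op f g).1 = (op f' g).1 + (op f g').1
  scaling : ∀ f g f' g' : latticeFn lam, f'.1 = rescale f.1 → g'.1 = rescale g.1 →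
    rescale (op f g).1 = (op f' g').1
  parity : ∀ f g f' g' : latticeFn lam, f'.1 = reflect f.1 → g'.1 = reflect g.1 →
    reflect (op f g).1 = (op f' g').1

/-- The triads at unity `1 = p + q` on the lattice with spacing `2`:
`1 = 2 - 1 = -1 + 2 = 1/2 + 1/2`. -/
def dyadicTable (lam : ℝ) : Fin 3 → logLattice lam × logLattice lam :=
  ![(pt lam 1, -pt lam 0), (-pt lam 0, pt lam 1), (pt lam (-1), pt lam (-1))]

/-- The six triads at unity that come from `1 = lam ^ b - lam ^ a`. -/
def trinomialTable (lam : ℝ) (a b : ℤ) : Fin 6 → logLattice lam × logLattice lam :=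
  ![(pt lam b, -pt lam a), (-pt lam a, pt lam b),
    (pt lam (b - a), -pt lam (-a)), (-pt lam (-a), pt lam (b - a)),
    (pt lam (-b), pt lam (a - b)), (pt lam (a - b), pt lam (-b))]

/-- The operation `(f ∗ g)(k) = ∑ⱼ f (pⱼ k) g (qⱼ k)` for a list of pairs `(pⱼ, qⱼ)`. -/
def tableProd {lam : ℝ} {n : ℕ} (T : Fin n → logLattice lam × logLattice lam)
    (f g : logLattice lam → ℂ) : logLattice lam → ℂ :=
  fun k => ∑ j, f ((T j).1 * k) * g ((T j).2 * k)

/-- The plastic number. -/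
def plastic : ℝ :=
  ((9 + √69) ^ (1 / 3 : ℝ) + (9 - √69) ^ (1 / 3 : ℝ)) / (18 : ℝ) ^ (1 / 3 : ℝ)

/-- The product on the lattice with spacing `2`, with a real prefactor `c`. -/
def prodDyadic (lam c : ℝ) (f g : logLattice lam → ℂ) : logLattice lam → ℂ :=
  c • tableProd (dyadicTable lam) f g

/-- The product on the lattice with `1 = lam ^ b - lam ^ a`, with a real prefactor `c`. -/
def prodTrinomial (lam : ℝ) (a b : ℕ) (c : ℝ) (f g : logLattice lam → ℂ) : logLattice lam → ℂ :=
  c • tableProd (trinomialTable lam a b) f g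

/-- The products on the lattice whose spacing `lam` is the plastic number: its twelve triads at
unity are the six from `1 = lam ^ 3 - lam` and the six from `1 = lam ^ 5 - lam ^ 4`. -/
def prodPlastic (lam c₁ c₂ : ℝ) (f g : logLattice lam → ℂ) : logLattice lam → ℂ :=
  c₁ • tableProd (trinomialTable lam 1 3) f g + c₂ • tableProd (trinomialTable lam 4 5) f g

/-- The spacing `lam` satisfies `1 = lam ^ b - lam ^ a` with coprime `0 ≤ a < b ≤ 62`, where
the pair is not one of those that give `lam = 2` or the plastic number. -/
def IsTrinomialSpacing (lam : ℝ) (a b : ℕ) : Prop :=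
  a < b ∧ b ≤ 62 ∧ Nat.Coprime a b ∧
    (a, b) ≠ (0, 1) ∧ (a, b) ≠ (1, 3) ∧ (a, b) ≠ (4, 5) ∧ 1 = lam ^ b - lam ^ a

/-- Associativity of an operation fails for some absolutely summable functions that satisfy the
reality condition. -/
def NotAssociative {lam : ℝ}
    (op : (logLattice lam → ℂ) → (logLattice lam → ℂ) → logLattice lam → ℂ) : Prop :=
  ∃ f ∈ latticeFn lam, ∃ g ∈ latticeFn lam, ∃ h ∈ latticeFn lam,
    op (op f g) h ≠ op f (op g h)

/-- `1 + lam ^ b` is not a lattice point, and associativity of `op` fails for the delta functions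
at `p = lam ^ (2 b)`, `q = -lam ^ (a + b)`, `r = -lam ^ a`. -/
def DeltaWitness {lam : ℝ} (a b : ℕ)
    (op : (logLattice lam → ℂ) → (logLattice lam → ℂ) → logLattice lam → ℂ) : Prop :=
  1 + lam ^ b ∉ logLattice lam ∧
    op (op (delta (pt lam (2 * b))) (delta (-pt lam (a + b)))) (delta (-pt lam a)) ≠
      op (delta (pt lam (2 * b))) (op (delta (-pt lam (a + b))) (delta (-pt lam a)))

end LogLattice

end

/-!
Extended complex-bilinearly, a product with the symmetries is determined by its structure constants
`⟨δ_x ∗ δ_y, δ_z⟩`. They are symmetric in `x, y, z`, vanish unless `x + y + z = 0` by the Leibniz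
rule, and are invariant under multiplication by powers of `λ`. A nonzero product therefore has a
nonzero constant `c` on a triad `1 = λ ^ b - λ ^ a`, and with `p = λ ^ (2 b)`, `q = -λ ^ (a + b)`,
`r = -λ ^ a` one has `(δ_p ∗ δ_q) ∗ δ_r = c ^ 2 δ_1`, whereas `δ_q ∗ δ_r = 0` because
`q + r = -λ ^ a (1 + λ ^ b)` is not a lattice point. Indeed `1 + λ ^ b = λ ^ n` would hold for every
conjugate of the unit `λ`, and one of these lies in the closed unit disc, where it fails if
`0 < a`; if `a = 0`, then `λ ^ b = 2` and `λ ^ n = 3`, which contradicts `2 ^ n ≠ 3 ^ b`.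
-/

open Polynomial in
/-- The constant coefficient is, up to sign, the product of the roots. -/
theorem exists_isRoot_norm_le_one {p : ℂ[X]} (hp : p.Monic) (hdeg : p.natDegree ≠ 0)
    (h0 : ‖p.coeff 0‖ ≤ 1) : ∃ z, p.IsRoot z ∧ ‖z‖ ≤ 1 := by
  have hsplit : p.Splits := IsAlgClosed.splits p
  have hroots : p.roots ≠ 0 := by
    rwa [← Multiset.card_pos, Nat.pos_iff_ne_zero, ← hsplit.natDegree_eq_card_roots]
  have hnorm : ‖p.coeff 0‖ = (p.roots.map fun z => ‖z‖).prod := by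
    rw [hsplit.coeff_zero_eq_prod_roots_of_monic hp, norm_mul, norm_pow, norm_neg, norm_one,
      one_pow, one_mul]
    exact map_multiset_prod (normHom : ℂ →*₀ ℝ) _
  by_contra! hlarge
  have hprod := Multiset.prod_map_lt_prod_map hroots (fun _ => (1 : ℝ)) (fun z => ‖z‖)
    (fun _ _ => one_pos) fun z hz => hlarge z (isRoot_of_mem_roots hz)
  rw [Multiset.map_const', Multiset.prod_replicate, one_pow, ← hnorm] at hprod
  exact hprod.not_ge h0

open Polynomial in
theorem exists_conjugate_norm_le_one {R : Type*} [CommRing R] [IsDomain R] [CharZero R] {x : R}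
    {p : ℤ[X]} (hp : p.Monic) (h0 : IsUnit (p.coeff 0)) (hx : aeval x p = 0) :
    ∃ z : ℂ, ‖z‖ ≤ 1 ∧ ∀ q : ℤ[X], aeval x q = 0 → aeval z q = 0 := by
  have hint : IsIntegral ℤ x := ⟨p, hp, hx⟩
  have hdvd : ∀ q : ℤ[X], aeval x q = 0 → minpoly ℤ x ∣ q := fun q hq =>
    minpoly.isIntegrallyClosed_dvd hint hq
  have hunit : IsUnit ((minpoly ℤ x).coeff 0) := by
    obtain ⟨r, hr⟩ := hdvd p hx
    rw [hr, mul_coeff_zero] at h0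
    exact isUnit_of_mul_isUnit_left h0
  have hmonic := minpoly.monic hint
  obtain ⟨z, hroot, hz⟩ :=
    exists_isRoot_norm_le_one (p := (minpoly ℤ x).map (Int.castRingHom ℂ)) (hmonic.map _)
      (by rw [hmonic.natDegree_map]; exact (minpoly.natDegree_pos hint).ne')
      (by rcases Int.isUnit_iff.1 hunit with h | h <;> simp [h])
  refine ⟨z, hz, fun q hq => aeval_eq_zero_of_dvd_aeval_eq_zero (hdvd q hq) ?_⟩
  rwa [IsRoot.def, eval_map] at hroot

theorem eq_zero_of_norm_add_le_of_norm_sub_le {E : Type*} [NormedAddCommGroup E]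
    [InnerProductSpace ℝ E] {u e : E} (hadd : ‖u + e‖ ≤ ‖e‖) (hsub : ‖u - e‖ ≤ ‖e‖) : u = 0 := by
  have h := parallelogram_law_with_norm ℝ u e
  have hu : ‖u‖ * ‖u‖ ≤ 0 := by
    linarith [mul_self_le_mul_self (norm_nonneg _) hadd, mul_self_le_mul_self (norm_nonneg _) hsub]
  simpa using hu.antisymm (mul_self_nonneg _)

theorem two_pow_ne_three_pow {m n : ℕ} (hm : m ≠ 0) : 2 ^ m ≠ 3 ^ n := fun h =>
  Nat.not_even_iff_odd.2 (Odd.pow (by decide : Odd 3)) (h ▸ even_two.pow_of_ne_zero hm)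

open Polynomial in
/-- The conjugate `z` of the unit `x` has `|z ^ a| ≤ 1` and `|z ^ a + 2| = |z ^ n| ≤ 1`, whence
`z ^ a = -1` and `z ^ b = 0`. -/
theorem one_add_pow_ne_pow_of_ne_zero {R : Type*} [CommRing R] [IsDomain R] [CharZero R] {x : R}
    {a b : ℕ} (ha : a ≠ 0) (hlt : a < b) (hab : x ^ b = x ^ a + 1) (n : ℕ) :
    1 + x ^ b ≠ x ^ n := by
  intro hn
  have hb : b ≠ 0 := (ha.bot_lt.trans hlt).ne'
  have hmonic : (X ^ b - (X ^ a + 1) : ℤ[X]).Monic :=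
    monic_X_pow_sub ((by compute_degree! : degree (X ^ a + 1 : ℤ[X]) ≤ a).trans_lt
      (by exact_mod_cast hlt))
  obtain ⟨z, hz, hconj⟩ := exists_conjugate_norm_le_one (x := x) hmonic
    (by simp [coeff_X_pow, ha.symm, hb.symm]) (by simp [hab])
  have hzb : z ^ b = z ^ a + 1 := by
    have h := hconj (X ^ b - (X ^ a + 1)) (by simp [hab])
    simpa [sub_eq_zero] using h
  have hzn : 1 + z ^ b = z ^ n := by
    have h := hconj (1 + X ^ b - X ^ n) (by simp [hn])
    simpa [sub_eq_zero] using h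
  have hpow : ∀ m, ‖z ^ m‖ ≤ 1 := fun m => by
    rw [norm_pow]; exact pow_le_one₀ (norm_nonneg _) hz
  have hza : z ^ a + 1 = 0 := by
    apply eq_zero_of_norm_add_le_of_norm_sub_le (e := (1 : ℂ))
    · rw [norm_one, ← hzb, add_comm, hzn]
      exact hpow n
    · rw [norm_one, add_sub_cancel_right]
      exact hpow a
  rw [hza, pow_eq_zero_iff hb] at hzb
  simp [hzb, ha] at hza

theorem lt_of_one_eq_pow_sub_pow {x : ℝ} (hx : 1 < x) {a b : ℕ} (hab : 1 = x ^ b - x ^ a) :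
    a < b := (pow_lt_pow_iff_right₀ hx).1 (by linarith)

theorem one_add_pow_ne_pow {x : ℝ} (hx : 1 < x) {a b : ℕ} (hab : 1 = x ^ b - x ^ a) (n : ℕ) :
    1 + x ^ b ≠ x ^ n := by
  rcases eq_or_ne a 0 with rfl | ha
  · intro h
    have hb : x ^ b = 2 := by rw [pow_zero] at hab; linarith
    have hn : x ^ n = 3 := by linarith
    refine two_pow_ne_three_pow (m := n) (n := b) ?_ ?_
    · rintro rfl; norm_num at hn
    · exact_mod_cast (by rw [← hb, ← hn, pow_right_comm] : (2 : ℝ) ^ n = 3 ^ b)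
  · exact one_add_pow_ne_pow_of_ne_zero ha (lt_of_one_eq_pow_sub_pow hx hab) (by linarith) n

theorem rpow_one_div_three_pow {y : ℝ} (hy : 0 ≤ y) : (y ^ (1 / 3 : ℝ)) ^ 3 = y := by
  simpa using Real.rpow_inv_natCast_pow hy three_ne_zero

namespace LogLattice

theorem one_add_pow_notMem {lam : ℝ} (hlam : 1 < lam) {a b : ℕ} (hab : 1 = lam ^ b - lam ^ a) :
    1 + lam ^ b ∉ logLattice lam := by
  have h0 : 0 < lam := one_pos.trans hlam
  have hb : 0 < lam ^ b := pow_pos h0 b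
  rintro ⟨n, h | h⟩
  · have hn : 0 < n := by
      rw [← one_lt_zpow_iff_right₀ hlam, ← h]
      linarith
    lift n to ℕ using hn.le
    exact one_add_pow_ne_pow hlam hab n (by rwa [zpow_natCast] at h)
  · linarith [zpow_pos h0 n]

/-- Cardano's formula: with `u`, `v`, `w` the cube roots of `9 + √69`, `9 - √69` and `18`, one has
`3 u v = w ^ 2`, so `(u + v) / w` is a root of `x ^ 3 - x - 1`. -/
theorem plastic_pow_three : plastic ^ 3 = plastic + 1 := by
  have hs : √69 ^ 2 = 69 := Real.sq_sqrt (by norm_num)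
  have hs9 : √69 ≤ 9 := by
    rw [Real.sqrt_le_left (by norm_num)]
    norm_num
  have hplus : 0 ≤ 9 + √69 := by positivity
  have hminus : 0 ≤ 9 - √69 := sub_nonneg.2 hs9
  have hu := rpow_one_div_three_pow hplus
  have hv := rpow_one_div_three_pow hminus
  have hw := rpow_one_div_three_pow (y := 18) (by norm_num)
  have hu0 := Real.rpow_nonneg hplus (1 / 3)
  have hv0 := Real.rpow_nonneg hminus (1 / 3)
  have hw0 : 0 < (18 : ℝ) ^ (1 / 3 : ℝ) := by positivity
  unfold plastic
  generalize (9 + √69) ^ (1 / 3 : ℝ) = u at *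
  generalize (9 - √69) ^ (1 / 3 : ℝ) = v at *
  generalize (18 : ℝ) ^ (1 / 3 : ℝ) = w at *
  have huv : 3 * (u * v) = w ^ 2 := by
    refine (pow_left_inj₀ (by positivity) (by positivity) three_ne_zero).1 ?_
    calc (3 * (u * v)) ^ 3 = 27 * (u ^ 3 * v ^ 3) := by ring
      _ = (w ^ 3) ^ 2 := by rw [hu, hv, hw]; linear_combination -27 * hs
      _ = (w ^ 2) ^ 3 := by ring
  field_simp
  linear_combination hu + hv - hw + (u + v) * huv

end LogLattice

section Bilinear

variable {R M N : Type*} [CommSemiring R] [AddCommMonoid M] [Module R M] [AddCommMonoid N]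
  [Module R N]

open Submodule in
theorem invariant_of_mem_span (m : M →ₗ[R] M →ₗ[R] M) (φ : M →ₗ[R] M →ₗ[R] N) {s : Set M}
    (h : ∀ f ∈ s, ∀ g ∈ s, ∀ k ∈ s, φ (m f g) k = φ f (m g k)) {f g k : M}
    (hf : f ∈ span R s) (hg : g ∈ span R s) (hk : k ∈ span R s) : φ (m f g) k = φ f (m g k) := by
  have hright : ∀ f ∈ s, ∀ g ∈ s, φ (m f g) k = φ f (m g k) := fun f hf g hg =>
    LinearMap.eqOn_span (f := φ (m f g)) (g := φ f ∘ₗ m g) (h f hf g hg) hk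
  have hmiddle : ∀ f ∈ s, φ (m f g) k = φ f (m g k) := fun f hf =>
    LinearMap.eqOn_span (f := φ.flip k ∘ₗ m f) (g := φ f ∘ₗ m.flip k) (hright f hf) hg
  exact LinearMap.eqOn_span (f := φ.flip k ∘ₗ m.flip g) (g := φ.flip (m g k)) hmiddle hf

end Bilinear

section Complexification

open Complex ComplexStarModule

variable {A : Type*} [AddCommGroup A] [Module ℂ A] [StarAddMonoid A] [StarModule ℂ A]

theorem realPart_star (f : A) : ℜ (star f) = ℜ f := by
  ext
  simp [realPart_apply_coe, add_comm]

theorem imaginaryPart_star (f : A) : ℑ (star f) = -ℑ f := by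
  ext
  simp [imaginaryPart_apply_coe, ← smul_neg]

/-- The complex bilinear extension of a real bilinear product on the self-adjoint elements. -/
noncomputable def complexify (m : selfAdjoint A →ₗ[ℝ] selfAdjoint A →ₗ[ℝ] selfAdjoint A) :
    A →ₗ[ℂ] A →ₗ[ℂ] A :=
  LinearMap.mk₂ ℂ
    (fun f g => (m (ℜ f) (ℜ g) - m (ℑ f) (ℑ g) : A) + I • (m (ℜ f) (ℑ g) + m (ℑ f) (ℜ g) : A))
    (fun f f' g => by
      simp only [map_add, LinearMap.add_apply, AddSubgroup.coe_add]
      module)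
    (fun c f g => by
      conv_rhs => rw [← re_add_im c]
      simp only [realPart_smul, imaginaryPart_smul, map_add, map_sub, map_smul,
        LinearMap.add_apply, LinearMap.sub_apply, LinearMap.smul_apply, AddSubgroup.coe_add,
        AddSubgroup.coe_sub, selfAdjoint.val_smul, ← Complex.coe_smul]
      match_scalars <;> first | ring1 | linear_combination -(c.im : ℂ) * I_mul_I)
    (fun f g g' => by
      simp only [map_add, AddSubgroup.coe_add]
      module)
    (fun c f g => by
      conv_rhs => rw [← re_add_im c]
      simp only [realPart_smul, imaginaryPart_smul, map_add, map_sub, map_smul,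
        AddSubgroup.coe_add, AddSubgroup.coe_sub, selfAdjoint.val_smul, ← Complex.coe_smul]
      match_scalars <;> first | ring1 | linear_combination -(c.im : ℂ) * I_mul_I)

variable (m : selfAdjoint A →ₗ[ℝ] selfAdjoint A →ₗ[ℝ] selfAdjoint A)

theorem complexify_apply (f g : A) : complexify m f g =
    (m (ℜ f) (ℜ g) - m (ℑ f) (ℑ g) : A) + I • (m (ℜ f) (ℑ g) + m (ℑ f) (ℜ g) : A) := rfl

theorem complexify_coe (f g : selfAdjoint A) : complexify m f g = m f g := by
  simp [complexify_apply]

theorem complexify_star (f g : A) :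
    complexify m (star f) (star g) = star (complexify m f g) := by
  simp [complexify_apply, realPart_star, imaginaryPart_star]

variable {m}

theorem complexify_comm (h : ∀ f g, m f g = m g f) (f g : A) :
    complexify m f g = complexify m g f := by
  simp only [complexify_apply, h (ℜ g), h (ℑ g)]
  rw [add_comm (m (ℜ f) (ℑ g) : A)]

end Complexification

namespace LogLattice

variable {lam : ℝ}

section Lattice

@[simp] theorem coe_neg (k : logLattice lam) : ((-k : logLattice lam) : ℝ) = -k := rfl

@[simp] theorem coe_mul (k l : logLattice lam) : ((k * l : logLattice lam) : ℝ) = k * l := rfl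

@[simp] theorem coe_pt (n : ℤ) : (pt lam n : ℝ) = lam ^ n := rfl

instance : HasDistribNeg (logLattice lam) :=
  Subtype.val_injective.hasDistribNeg _ coe_neg coe_mul

theorem exists_eq_pt_or_eq_neg_pt (k : logLattice lam) : ∃ n, k = pt lam n ∨ k = -pt lam n := by
  obtain ⟨k, n, rfl | rfl⟩ := k
  exacts [⟨n, Or.inl rfl⟩, ⟨n, Or.inr rfl⟩]

theorem coe_ne_zero (h : 0 < lam) (k : logLattice lam) : (k : ℝ) ≠ 0 := by
  obtain ⟨k, n, rfl | rfl⟩ := k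
  exacts [zpow_ne_zero n h.ne', neg_ne_zero.2 (zpow_ne_zero n h.ne')]

theorem inv_mem {k : ℝ} (hk : k ∈ logLattice lam) : k⁻¹ ∈ logLattice lam := by
  obtain ⟨n, rfl | rfl⟩ := hk
  · exact ⟨-n, Or.inl (zpow_neg lam n).symm⟩
  · exact ⟨-n, Or.inr (by rw [inv_neg, zpow_neg])⟩

theorem coe_mul_mem_iff (h : 0 < lam) (k : logLattice lam) {x : ℝ} :
    k * x ∈ logLattice lam ↔ x ∈ logLattice lam := by
  refine ⟨fun hx => ?_, mul_mem k.2⟩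
  rw [← inv_mul_cancel_left₀ (coe_ne_zero h k) x]
  exact mul_mem (inv_mem k.2) hx

theorem pt_add (h : lam ≠ 0) (m n : ℤ) : pt lam (m + n) = pt lam m * pt lam n :=
  Subtype.ext (zpow_add₀ h m n)

theorem pt_injective (hlam : 1 < lam) : Function.Injective (pt lam) := fun _ _ h =>
  zpow_right_injective₀ (one_pos.trans hlam) hlam.ne' (congrArg Subtype.val h)

theorem pt_ne_neg_pt (h : 0 < lam) (m n : ℤ) : pt lam m ≠ -pt lam n := fun heq =>
  (zpow_pos h m).not_gt ((congrArg Subtype.val heq).trans_lt (neg_neg_of_pos (zpow_pos h n)))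

end Lattice

section Delta

theorem delta_self (p : logLattice lam) : delta p p = 1 := if_pos rfl

theorem delta_of_ne {p k : logLattice lam} (h : k ≠ p) : delta p k = 0 := if_neg h

open Classical in
theorem delta_mul_delta (p q k l : logLattice lam) :
    delta p k * delta q l = if k = p ∧ l = q then 1 else 0 := by
  rw [ite_and, delta, delta, ite_mul, one_mul, zero_mul]

theorem star_delta_neg (p k : logLattice lam) :
    starRingEnd ℂ (delta p (-k)) = delta (-p) k := by
  by_cases h : k = -p
  · simp [h, delta_self]
  · rw [delta_of_ne h, delta_of_ne (fun h' => h (neg_eq_iff_eq_neg.1 h')), map_zero]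

end Delta

section SummableFn

/-- The complex vector space of absolutely summable functions on the lattice. -/
def summableFn (lam : ℝ) : Submodule ℂ (logLattice lam → ℂ) where
  carrier := {f | Summable fun k => ‖f k‖}
  zero_mem' := by simp
  add_mem' := fun hf hg =>
    (Summable.add hf hg).of_nonneg_of_le (fun _ => norm_nonneg _) fun _ => norm_add_le _ _
  smul_mem' := fun c f hf => by simpa [norm_smul] using Summable.mul_left ‖c‖ hf

theorem mem_summableFn {f : logLattice lam → ℂ} :
    f ∈ summableFn lam ↔ Summable fun k => ‖f k‖ := Iff.rfl

/-- The conjugation `k ↦ conj (f (-k))`, for which `latticeFn` is the space of self-adjoint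
elements. -/
instance : StarAddMonoid (summableFn lam) where
  star f := ⟨fun k => starRingEnd ℂ (f.1 (-k)), by
    simpa only [mem_summableFn, RCLike.norm_conj, Function.comp_def] using
      (mem_summableFn.1 f.2).comp_injective neg_injective⟩
  star_involutive f := by ext; simp
  star_add f g := by ext; simp

theorem star_apply (f : summableFn lam) (k : logLattice lam) :
    (star f).1 k = starRingEnd ℂ (f.1 (-k)) := rfl

instance : StarModule ℂ (summableFn lam) where
  star_smul c f := by ext; simp [star_apply]

theorem isSelfAdjoint_iff {f : summableFn lam} : IsSelfAdjoint f ↔ f.1 ∈ latticeFn lam := by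
  have hconj : IsSelfAdjoint f ↔ ∀ k, f.1 (-k) = starRingEnd ℂ (f.1 k) := by
    rw [IsSelfAdjoint, ← SetLike.coe_eq_coe, funext_iff]
    refine forall_congr' fun k => ?_
    rw [star_apply, starRingEnd_apply, star_eq_iff_star_eq, eq_comm, ← starRingEnd_apply]
  exact hconj.trans (iff_self_and.2 fun _ => f.2)

/-- The elements of `latticeFn` as self-adjoint absolutely summable functions. -/
def selfAdjointEquiv : latticeFn lam ≃ₗ[ℝ] selfAdjoint (summableFn lam) where
  toFun f := ⟨⟨f.1, f.2.2⟩, isSelfAdjoint_iff.2 f.2⟩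
  invFun f := ⟨f.1.1, isSelfAdjoint_iff.1 f.2⟩
  map_add' _ _ := rfl
  map_smul' _ _ := rfl

open Complex ComplexStarModule in
theorem coe_mem_span (f : summableFn lam) :
    f.1 ∈ Submodule.span ℂ (latticeFn lam : Set (logLattice lam → ℂ)) := by
  have hself : ∀ g : selfAdjoint (summableFn lam), g.1.1 ∈ (latticeFn lam : Set _) := fun g =>
    isSelfAdjoint_iff.1 g.2
  rw [← realPart_add_I_smul_imaginaryPart f]
  exact add_mem (Submodule.subset_span (hself _))
    (Submodule.smul_mem _ _ (Submodule.subset_span (hself _)))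

/-- `delta p` as an absolutely summable function. -/
noncomputable def single (p : logLattice lam) : summableFn lam :=
  ⟨delta p, mem_summableFn.2 <| summable_of_ne_finset_zero (s := {p}) fun k hk => by
    rw [delta_of_ne (by simpa using hk), norm_zero]⟩

theorem coe_single (p : logLattice lam) : (single p).1 = delta p := rfl

theorem star_single (p : logLattice lam) : star (single p) = single (-p) :=
  Subtype.ext (funext (star_delta_neg p))

theorem single_ne_zero (p : logLattice lam) : single p ≠ 0 := fun h =>
  one_ne_zero ((delta_self p).symm.trans (congrFun (congrArg Subtype.val h) p))

theorem summable_mul_apply_neg (f g : summableFn lam) :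
    Summable fun k => f.1 k * g.1 (-k) :=
  (summable_mul_of_summable_norm f.2 g.2).comp_injective (i := fun k => (k, -k))
    fun _ _ h => congrArg Prod.fst h

/-- The bilinear pairing `∑ₖ f (k) g (-k)`, which agrees with the inner product on `latticeFn`. -/
noncomputable def pairing : summableFn lam →ₗ[ℂ] summableFn lam →ₗ[ℂ] ℂ :=
  LinearMap.mk₂ ℂ (fun f g => ∑' k, f.1 k * g.1 (-k))
    (fun f f' g => by
      simp only [← (summable_mul_apply_neg f g).tsum_add (summable_mul_apply_neg f' g),
        Submodule.coe_add, Pi.add_apply, add_mul])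
    (fun c f g => by
      simp only [Submodule.coe_smul, Pi.smul_apply, smul_eq_mul, mul_assoc, tsum_mul_left])
    (fun f g g' => by
      simp only [← (summable_mul_apply_neg f g).tsum_add (summable_mul_apply_neg f g'),
        Submodule.coe_add, Pi.add_apply, mul_add])
    (fun c f g => by
      simp only [Submodule.coe_smul, Pi.smul_apply, smul_eq_mul, mul_left_comm _ c, tsum_mul_left])

theorem pairing_apply (f g : summableFn lam) : pairing f g = ∑' k, f.1 k * g.1 (-k) := rfl

theorem pairing_comm (f g : summableFn lam) : pairing f g = pairing g f := by
  rw [pairing_apply, pairing_apply, ← (Equiv.neg (logLattice lam)).tsum_eq]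
  simp [mul_comm]

theorem pairing_eq_innerProd {f g : summableFn lam} (hg : IsSelfAdjoint g) :
    pairing f g = innerProd f.1 g.1 :=
  tsum_congr fun k => by rw [(isSelfAdjoint_iff.1 hg).1]

theorem pairing_single (f : summableFn lam) (z : logLattice lam) :
    pairing f (single z) = f.1 (-z) := by
  rw [pairing_apply, tsum_eq_single (-z) fun k hk => by
    rw [coe_single, delta_of_ne (fun h => hk (neg_eq_iff_eq_neg.1 h)), mul_zero]]
  rw [coe_single, neg_neg, delta_self, mul_one]

end SummableFn

section Triad

/-- The product `m` vanishes on the pairs `e p`, `e q` for which `p + q` is not a lattice point, and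
on the triads `lam ^ n = lam ^ (b + n) - lam ^ (a + n)` it sends the pair of summands to
`c • e (lam ^ n)`. -/
structure HasTriadCoeff {𝕜 V : Type*} [CommSemiring 𝕜] [AddCommMonoid V] [Module 𝕜 V]
    (e : logLattice lam → V) (m : V →ₗ[𝕜] V →ₗ[𝕜] V) (a b : ℕ) (c : 𝕜) : Prop where
  apply_triad : ∀ n : ℤ, m (e (pt lam (b + n))) (e (-pt lam (a + n))) = c • e (pt lam n)
  apply_eq_zero : ∀ p q : logLattice lam, (p + q : ℝ) ∉ logLattice lam → m (e p) (e q) = 0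

namespace HasTriadCoeff

section CommSemiring

variable {𝕜 V : Type*} [CommSemiring 𝕜] [AddCommMonoid V] [Module 𝕜 V] {e : logLattice lam → V}
  {m m' : V →ₗ[𝕜] V →ₗ[𝕜] V} {a b : ℕ} {c c' : 𝕜}

theorem add (h : HasTriadCoeff e m a b c) (h' : HasTriadCoeff e m' a b c') :
    HasTriadCoeff e (m + m') a b (c + c') where
  apply_triad n := by
    rw [LinearMap.add_apply, LinearMap.add_apply, h.apply_triad, h'.apply_triad, add_smul]
  apply_eq_zero p q hpq := by
    rw [LinearMap.add_apply, LinearMap.add_apply, h.apply_eq_zero p q hpq,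
      h'.apply_eq_zero p q hpq, add_zero]

theorem smul (h : HasTriadCoeff e m a b c) (r : 𝕜) : HasTriadCoeff e (r • m) a b (r * c) where
  apply_triad n := by rw [LinearMap.smul_apply, LinearMap.smul_apply, h.apply_triad, mul_smul]
  apply_eq_zero p q hpq := by
    rw [LinearMap.smul_apply, LinearMap.smul_apply, h.apply_eq_zero p q hpq, smul_zero]

end CommSemiring

/-- The left side is `c ^ 2 • e 1`, while `-lam ^ (a + b) - lam ^ a = -lam ^ a * (1 + lam ^ b)` is
not a lattice point, so the right side vanishes. -/
theorem not_associative {𝕜 V : Type*} [Field 𝕜] [AddCommGroup V] [Module 𝕜 V]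
    {e : logLattice lam → V} {m : V →ₗ[𝕜] V →ₗ[𝕜] V} {a b : ℕ} {c : 𝕜}
    (h : HasTriadCoeff e m a b c) (hlam : 0 < lam) (hc : c ≠ 0) (he : e (pt lam 0) ≠ 0)
    (hb : 1 + lam ^ b ∉ logLattice lam) :
    m (m (e (pt lam (2 * b))) (e (-pt lam (a + b)))) (e (-pt lam a)) ≠
      m (e (pt lam (2 * b))) (m (e (-pt lam (a + b))) (e (-pt lam a))) := by
  have hone : m (e (pt lam b)) (e (-pt lam a)) = c • e (pt lam 0) := by
    simpa only [add_zero] using h.apply_triad 0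
  have hscaled : m (e (pt lam (2 * b))) (e (-pt lam (a + b))) = c • e (pt lam b) := by
    rw [two_mul]
    exact h.apply_triad b
  have hzero : m (e (-pt lam (a + b))) (e (-pt lam a)) = 0 := by
    refine h.apply_eq_zero _ _ ?_
    have hsum : ((-pt lam (a + b) : logLattice lam) + (-pt lam a : logLattice lam) : ℝ) =
        (-pt lam a : logLattice lam) * (1 + lam ^ b) := by
      simp only [coe_neg, coe_pt, zpow_add₀ hlam.ne', zpow_natCast]
      ring
    rwa [hsum, coe_mul_mem_iff hlam]
  rw [hzero, map_zero, hscaled, map_smul, LinearMap.smul_apply, hone]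
  exact smul_ne_zero hc (smul_ne_zero hc he)

end HasTriadCoeff

end Triad

section Table

variable {n : ℕ} {T : Fin n → logLattice lam × logLattice lam}

/-- `tableProd` as a bilinear map. -/
noncomputable def tableProdHom (T : Fin n → logLattice lam × logLattice lam) :
    (logLattice lam → ℂ) →ₗ[ℂ] (logLattice lam → ℂ) →ₗ[ℂ] (logLattice lam → ℂ) :=
  LinearMap.mk₂ ℂ (tableProd T)
    (fun f f' g => by
      ext k; simp [tableProd, add_mul, Finset.sum_add_distrib])
    (fun c f g => by
      ext k; simp [tableProd, Finset.mul_sum, mul_assoc])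
    (fun f g g' => by
      ext k; simp [tableProd, mul_add, Finset.sum_add_distrib])
    (fun c f g => by
      ext k; simp [tableProd, Finset.mul_sum, mul_left_comm])

theorem tableProdHom_apply (f g : logLattice lam → ℂ) :
    tableProdHom T f g = tableProd T f g := rfl

/-- All pairs of the table are triads at unity `1 = p + q`. -/
def IsTriadTable (T : Fin n → logLattice lam × logLattice lam) : Prop :=
  ∀ j, ((T j).1 : ℝ) + (T j).2 = 1

theorem isTriadTable_dyadic : IsTriadTable (dyadicTable 2) := by
  intro j
  fin_cases j <;> simp [dyadicTable] <;> norm_num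

theorem isTriadTable_trinomial (h : 0 < lam) {a b : ℕ} (hab : 1 = lam ^ b - lam ^ a) :
    IsTriadTable (trinomialTable lam a b) := by
  have ha : lam ^ a ≠ 0 := by positivity
  have hb : lam ^ b ≠ 0 := by positivity
  intro j
  fin_cases j <;> simp [trinomialTable, zpow_sub₀ h.ne'] <;> field_simp <;> linarith

open Classical in
/-- The number of occurrences of the pair `t` in a table. -/
noncomputable def multiplicity (T : Fin n → logLattice lam × logLattice lam)
    (t : logLattice lam × logLattice lam) : ℕ :=
  Finset.card {j | T j = t}

theorem multiplicity_ne_zero {t : logLattice lam × logLattice lam} (j : Fin n) (h : T j = t) :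
    multiplicity T t ≠ 0 := by
  classical
  exact Finset.card_ne_zero.2 ⟨j, by simp [h]⟩

theorem multiplicity_eq_zero {t : logLattice lam × logLattice lam} (h : ∀ j, T j ≠ t) :
    multiplicity T t = 0 := by
  classical
  simp [multiplicity, h]

theorem mul_eq_mul_and_iff {R : Type*} [CommRing R] [IsDomain R] {x y u v k l : R}
    (hxy : x + y = 1) (huv : u + v = 1) (hk : k ≠ 0) :
    x * l = u * k ∧ y * l = v * k ↔ (x = u ∧ y = v) ∧ l = k := by
  refine ⟨fun ⟨hx, hy⟩ => ?_, by rintro ⟨⟨rfl, rfl⟩, rfl⟩; exact ⟨rfl, rfl⟩⟩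
  obtain rfl : l = k := by linear_combination hx + hy - l * hxy + k * huv
  exact ⟨⟨mul_right_cancel₀ hk hx, mul_right_cancel₀ hk hy⟩, rfl⟩

theorem IsTriadTable.tableProd_delta (hT : IsTriadTable T) (h : 0 < lam) {x y : logLattice lam}
    (hxy : (x : ℝ) + y = 1) (k : logLattice lam) :
    tableProd T (delta (x * k)) (delta (y * k)) = (multiplicity T (x, y) : ℂ) • delta k := by
  classical
  ext l
  have hiff : ∀ j, ((T j).1 * l = x * k ∧ (T j).2 * l = y * k) ↔ T j = (x, y) ∧ l = k := fun j => by
    simpa only [Subtype.ext_iff, Prod.ext_iff, coe_mul] using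
      mul_eq_mul_and_iff (hT j) hxy (coe_ne_zero h k)
  calc tableProd T (delta (x * k)) (delta (y * k)) l
      = ∑ j, (if T j = (x, y) then 1 else 0) * delta k l :=
        Finset.sum_congr rfl fun j _ => by
          rw [delta_mul_delta, if_congr (hiff j) rfl rfl, ite_and, delta, ite_mul, one_mul,
            zero_mul]
    _ = (multiplicity T (x, y) : ℂ) * delta k l := by
        rw [← Finset.sum_mul, Finset.sum_boole, multiplicity]

theorem IsTriadTable.tableProd_delta_eq_zero (hT : IsTriadTable T) {p q : logLattice lam}
    (hpq : (p : ℝ) + q ∉ logLattice lam) : tableProd T (delta p) (delta q) = 0 := by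
  ext l
  refine Finset.sum_eq_zero fun j _ => ?_
  rw [delta_mul_delta, if_neg]
  rintro ⟨rfl, rfl⟩
  exact hpq (by rw [coe_mul, coe_mul, ← add_mul, hT j, one_mul]; exact l.2)

theorem IsTriadTable.hasTriadCoeff (hT : IsTriadTable T) (h : 0 < lam) {a b : ℕ}
    (hab : 1 = lam ^ b - lam ^ a) :
    HasTriadCoeff delta (tableProdHom T) a b (multiplicity T (pt lam b, -pt lam a) : ℂ) where
  apply_triad n := by
    have htriad : ((pt lam b : logLattice lam) : ℝ) + (-pt lam a : logLattice lam) = 1 := by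
      simpa [← sub_eq_add_neg] using hab.symm
    rw [tableProdHom_apply, pt_add h.ne', pt_add h.ne', ← neg_mul, hT.tableProd_delta h htriad]
  apply_eq_zero _ _ := hT.tableProd_delta_eq_zero

theorem HasTriadCoeff.notAssociative_and_deltaWitness
    {m : (logLattice lam → ℂ) →ₗ[ℂ] (logLattice lam → ℂ) →ₗ[ℂ] (logLattice lam → ℂ)} {a b : ℕ}
    {c : ℂ} (h : HasTriadCoeff delta m a b c) (hc : c ≠ 0) (hlam : 1 < lam)
    (hab : 1 = lam ^ b - lam ^ a) :
    NotAssociative (fun f g => m f g) ∧ DeltaWitness a b (fun f g => m f g) := by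
  have hmem := one_add_pow_notMem hlam hab
  have hne := h.not_associative (one_pos.trans hlam) hc
    (fun h0 => one_ne_zero ((delta_self _).symm.trans (congrFun h0 _))) hmem
  refine ⟨?_, hmem, hne⟩
  by_contra hassoc
  simp only [NotAssociative, not_exists, not_and, not_not] at hassoc
  have hspan : ∀ p : logLattice lam, delta p ∈ Submodule.span ℂ (latticeFn lam : Set _) :=
    fun p => coe_mem_span (single p)
  exact hne (invariant_of_mem_span m m hassoc (hspan _) (hspan _) (hspan _))

end Table

section ExplicitProducts

theorem mul_multiplicity_trinomialTable_ne_zero (a b : ℤ) {c : ℝ} (hc : c ≠ 0) :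
    (c : ℂ) * multiplicity (trinomialTable lam a b) (pt lam b, -pt lam a) ≠ 0 :=
  mul_ne_zero (Complex.ofReal_ne_zero.2 hc) (Nat.cast_ne_zero.2 (multiplicity_ne_zero 0 rfl))

theorem prodDyadic_witness {c : ℝ} (hc : c ≠ 0) :
    NotAssociative (prodDyadic 2 c) ∧ DeltaWitness 0 1 (prodDyadic 2 c) := by
  have hab : (1 : ℝ) = 2 ^ 1 - 2 ^ 0 := by norm_num
  have hmult : multiplicity (dyadicTable 2) (pt 2 (1 : ℕ), -pt 2 (0 : ℕ)) ≠ 0 :=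
    multiplicity_ne_zero 0 rfl
  exact ((isTriadTable_dyadic.hasTriadCoeff two_pos hab).smul
    (c : ℂ)).notAssociative_and_deltaWitness
    (mul_ne_zero (Complex.ofReal_ne_zero.2 hc) (Nat.cast_ne_zero.2 hmult)) one_lt_two hab

theorem prodTrinomial_witness (hlam : 1 < lam) {a b : ℕ} (hab : 1 = lam ^ b - lam ^ a) {c : ℝ}
    (hc : c ≠ 0) :
    NotAssociative (prodTrinomial lam a b c) ∧ DeltaWitness a b (prodTrinomial lam a b c) := by
  have h0 : 0 < lam := one_pos.trans hlam
  exact (((isTriadTable_trinomial h0 hab).hasTriadCoeff h0 hab).smul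
    (c : ℂ)).notAssociative_and_deltaWitness
    (mul_multiplicity_trinomialTable_ne_zero _ _ hc) hlam hab

theorem prodPlastic_witness (hlam : 1 < lam) (h3 : lam ^ 3 = lam + 1) {c₁ c₂ : ℝ}
    (hc : c₁ ≠ 0 ∨ c₂ ≠ 0) :
    NotAssociative (prodPlastic lam c₁ c₂) ∧
      (c₁ ≠ 0 → DeltaWitness 1 3 (prodPlastic lam c₁ c₂)) ∧
      (c₂ ≠ 0 → DeltaWitness 4 5 (prodPlastic lam c₁ c₂)) := by
  have h0 : 0 < lam := one_pos.trans hlam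
  have h13 : 1 = lam ^ 3 - lam ^ 1 := by linear_combination -h3
  have h45 : 1 = lam ^ 5 - lam ^ 4 := by linear_combination (-(lam ^ 2 - lam + 1)) * h3
  have hT := isTriadTable_trinomial h0 h13
  have hT' := isTriadTable_trinomial h0 h45
  have hcross : multiplicity (trinomialTable lam (4 : ℕ) (5 : ℕ))
      (pt lam (3 : ℕ), -pt lam (1 : ℕ)) = 0 := multiplicity_eq_zero fun j => by
    fin_cases j <;> simp [trinomialTable, (pt_injective hlam).eq_iff, pt_ne_neg_pt h0]
  have hcross' : multiplicity (trinomialTable lam (1 : ℕ) (3 : ℕ))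
      (pt lam (5 : ℕ), -pt lam (4 : ℕ)) = 0 := multiplicity_eq_zero fun j => by
    fin_cases j <;> simp [trinomialTable, (pt_injective hlam).eq_iff, pt_ne_neg_pt h0]
  have hw₁ : c₁ ≠ 0 → NotAssociative (prodPlastic lam c₁ c₂) ∧
      DeltaWitness 1 3 (prodPlastic lam c₁ c₂) := fun hc₁ =>
    (((hT.hasTriadCoeff h0 h13).smul (c₁ : ℂ)).add
      ((hT'.hasTriadCoeff h0 h13).smul (c₂ : ℂ))).notAssociative_and_deltaWitness
      (by simpa only [hcross, Nat.cast_zero, mul_zero, add_zero] using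
        mul_multiplicity_trinomialTable_ne_zero _ _ hc₁) hlam h13
  have hw₂ : c₂ ≠ 0 → NotAssociative (prodPlastic lam c₁ c₂) ∧
      DeltaWitness 4 5 (prodPlastic lam c₁ c₂) := fun hc₂ =>
    (((hT.hasTriadCoeff h0 h45).smul (c₁ : ℂ)).add
      ((hT'.hasTriadCoeff h0 h45).smul (c₂ : ℂ))).notAssociative_and_deltaWitness
      (by simpa only [hcross', Nat.cast_zero, mul_zero, zero_add] using
        mul_multiplicity_trinomialTable_ne_zero _ _ hc₂) hlam h45
  exact ⟨hc.elim (fun h => (hw₁ h).1) fun h => (hw₂ h).1, fun h => (hw₁ h).2, fun h => (hw₂ h).2⟩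

end ExplicitProducts

/-- A product on the one-dimensional logarithmic lattice with scaling invariance. Reality is encoded
in the codomain `latticeFn` of `op`; as in `IsSymmetricProduct`, an element `f'` of `latticeFn`
stands for a derivative or rescaling of `f`. -/
structure IsScaleInvariantProduct (op : latticeFn lam → latticeFn lam → latticeFn lam) : Prop where
  bilinear : ∀ (f g h : latticeFn lam) (γ : ℝ), op (f + γ • g) h = op f h + γ • op g h
  comm : ∀ f g : latticeFn lam, op f g = op g f
  assoc_avg : ∀ f g h : latticeFn lam, innerProd (op f g).1 h.1 = innerProd f.1 (op g h).1
  leibniz : ∀ f g f' g' : latticeFn lam, f'.1 = partialD f.1 → g'.1 = partialD g.1 →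
    partialD (op f g).1 = (op f' g).1 + (op f g').1
  scaling : ∀ f g f' g' : latticeFn lam, f'.1 = rescale f.1 → g'.1 = rescale g.1 →
    rescale (op f g).1 = (op f' g').1

variable {op : latticeFn lam → latticeFn lam → latticeFn lam}

theorem IsSymmetricProduct.isScaleInvariantProduct (hop : IsSymmetricProduct op) :
    IsScaleInvariantProduct op :=
  ⟨hop.bilinear, hop.comm, hop.assoc_avg, hop.leibniz, hop.scaling⟩

section Parts

open Complex ComplexStarModule

variable {f f' : summableFn lam}

theorem realPart_of_eq_partialD (h : f'.1 = partialD f.1) :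
    (ℜ f').1.1 = partialD (ℜ f).1.1 := by
  ext k
  simp [realPart_apply_coe, star_apply, h, partialD]
  ring

theorem imaginaryPart_of_eq_partialD (h : f'.1 = partialD f.1) :
    (ℑ f').1.1 = partialD (ℑ f).1.1 := by
  ext k
  simp [imaginaryPart_apply_coe, star_apply, h, partialD]
  ring

theorem realPart_of_eq_rescale (h : f'.1 = rescale f.1) :
    (ℜ f').1.1 = rescale (ℜ f).1.1 := by
  ext k
  simp [realPart_apply_coe, star_apply, h, rescale]

theorem imaginaryPart_of_eq_rescale (h : f'.1 = rescale f.1) :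
    (ℑ f').1.1 = rescale (ℑ f).1.1 := by
  ext k
  simp [imaginaryPart_apply_coe, star_apply, h, rescale]

end Parts

namespace IsScaleInvariantProduct

section ComplexProd

open Complex ComplexStarModule

variable (hop : IsScaleInvariantProduct op)

/-- The product as a real bilinear map on the self-adjoint absolutely summable functions. -/
noncomputable def realProd : selfAdjoint (summableFn lam) →ₗ[ℝ] selfAdjoint (summableFn lam) →ₗ[ℝ]
    selfAdjoint (summableFn lam) :=
  have hadd : ∀ f g h, op (f + g) h = op f h + op g h := fun f g h => by
    simpa using hop.bilinear f g h 1
  have hsmul : ∀ (γ : ℝ) f h, op (γ • f) h = γ • op f h := fun γ f h => by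
    have hzero : op 0 h = 0 := by simpa using hadd 0 0 h
    simpa [hzero] using hop.bilinear 0 f h γ
  LinearMap.mk₂ ℝ
    (fun f g => selfAdjointEquiv (op (selfAdjointEquiv.symm f) (selfAdjointEquiv.symm g)))
    (fun f g h => by rw [map_add, hadd, map_add])
    (fun γ f g => by rw [map_smul, hsmul, map_smul])
    (fun f g h => by rw [map_add, hop.comm, hadd, map_add, hop.comm,
      hop.comm (selfAdjointEquiv.symm h)])
    (fun γ f g => by rw [map_smul, hop.comm, hsmul, map_smul, hop.comm])

/-- The complex bilinear extension of the product to all absolutely summable functions. -/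
noncomputable def complexProd : summableFn lam →ₗ[ℂ] summableFn lam →ₗ[ℂ] summableFn lam :=
  complexify hop.realProd

theorem complexProd_selfAdjointEquiv (f g : latticeFn lam) :
    hop.complexProd (selfAdjointEquiv f).1 (selfAdjointEquiv g).1 =
      (selfAdjointEquiv (op f g)).1 :=
  complexify_coe _ (selfAdjointEquiv f) (selfAdjointEquiv g)

theorem complexProd_apply (f g : summableFn lam) (k : logLattice lam) :
    (hop.complexProd f g).1 k =
      (op (selfAdjointEquiv.symm (ℜ f)) (selfAdjointEquiv.symm (ℜ g))).1 k -
        (op (selfAdjointEquiv.symm (ℑ f)) (selfAdjointEquiv.symm (ℑ g))).1 k +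
      I * ((op (selfAdjointEquiv.symm (ℜ f)) (selfAdjointEquiv.symm (ℑ g))).1 k +
        (op (selfAdjointEquiv.symm (ℑ f)) (selfAdjointEquiv.symm (ℜ g))).1 k) := rfl

theorem complexProd_comm (f g : summableFn lam) : hop.complexProd f g = hop.complexProd g f :=
  complexify_comm (fun _ _ => congrArg selfAdjointEquiv (hop.comm _ _)) f g

theorem complexProd_star (f g : summableFn lam) :
    hop.complexProd (star f) (star g) = star (hop.complexProd f g) :=
  complexify_star _ f g

theorem complexProd_invariant {N : Type*} [AddCommMonoid N] [Module ℂ N]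
    (φ : summableFn lam →ₗ[ℂ] summableFn lam →ₗ[ℂ] N)
    (h : ∀ f g k : latticeFn lam, φ (selfAdjointEquiv (op f g)).1 (selfAdjointEquiv k).1 =
      φ (selfAdjointEquiv f).1 (selfAdjointEquiv (op g k)).1) (f g k : summableFn lam) :
    φ (hop.complexProd f g) k = φ f (hop.complexProd g k) := by
  have htop : ∀ f : summableFn lam, f ∈ Submodule.span ℂ (selfAdjoint (summableFn lam) : Set _) :=
    fun f => by rw [span_selfAdjoint]; trivial
  have hself : ∀ f ∈ (selfAdjoint (summableFn lam) : Set _), ∃ u : latticeFn lam,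
      (selfAdjointEquiv u).1 = f := fun f hf =>
    ⟨selfAdjointEquiv.symm ⟨f, hf⟩, rfl⟩
  refine invariant_of_mem_span _ φ (fun f hf g hg k hk => ?_) (htop f) (htop g) (htop k)
  obtain ⟨u, rfl⟩ := hself f hf
  obtain ⟨v, rfl⟩ := hself g hg
  obtain ⟨w, rfl⟩ := hself k hk
  rw [complexProd_selfAdjointEquiv, complexProd_selfAdjointEquiv]
  exact h u v w

theorem complexProd_assoc (h : ∀ f g k, op (op f g) k = op f (op g k)) (f g k : summableFn lam) :
    hop.complexProd (hop.complexProd f g) k = hop.complexProd f (hop.complexProd g k) :=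
  hop.complexProd_invariant hop.complexProd
    (fun f g k => by rw [complexProd_selfAdjointEquiv, complexProd_selfAdjointEquiv, h]) f g k

theorem pairing_complexProd (f g k : summableFn lam) :
    pairing (hop.complexProd f g) k = pairing f (hop.complexProd g k) :=
  hop.complexProd_invariant pairing
    (fun f g k => by
      rw [pairing_eq_innerProd (selfAdjointEquiv k).2,
        pairing_eq_innerProd (selfAdjointEquiv (op g k)).2]
      exact hop.assoc_avg f g k) f g k

variable {f g f' g' : summableFn lam}

theorem complexProd_leibniz (hf : f'.1 = partialD f.1) (hg : g'.1 = partialD g.1) :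
    partialD (hop.complexProd f g).1 = (hop.complexProd f' g).1 + (hop.complexProd f g').1 := by
  have hleib : ∀ {u v u' v' : selfAdjoint (summableFn lam)} (k : logLattice lam),
      u'.1.1 = partialD u.1.1 → v'.1.1 = partialD v.1.1 →
      I * (k : ℝ) * (op (selfAdjointEquiv.symm u) (selfAdjointEquiv.symm v)).1 k =
        (op (selfAdjointEquiv.symm u') (selfAdjointEquiv.symm v)).1 k +
          (op (selfAdjointEquiv.symm u) (selfAdjointEquiv.symm v')).1 k :=
    fun k hu hv => congrFun (hop.leibniz _ _ _ _ hu hv) k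
  have hf₁ := realPart_of_eq_partialD hf
  have hf₂ := imaginaryPart_of_eq_partialD hf
  have hg₁ := realPart_of_eq_partialD hg
  have hg₂ := imaginaryPart_of_eq_partialD hg
  ext k
  simp only [partialD, Pi.add_apply, complexProd_apply]
  linear_combination hleib k hf₁ hg₁ - hleib k hf₂ hg₂ + I * (hleib k hf₁ hg₂ + hleib k hf₂ hg₁)

theorem complexProd_rescale (hf : f'.1 = rescale f.1) (hg : g'.1 = rescale g.1) :
    rescale (hop.complexProd f g).1 = (hop.complexProd f' g').1 := by
  have hscale : ∀ {u v u' v' : selfAdjoint (summableFn lam)} (k : logLattice lam),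
      u'.1.1 = rescale u.1.1 → v'.1.1 = rescale v.1.1 →
      (op (selfAdjointEquiv.symm u) (selfAdjointEquiv.symm v)).1 (pt lam 1 * k) =
        (op (selfAdjointEquiv.symm u') (selfAdjointEquiv.symm v')).1 k :=
    fun k hu hv => congrFun (hop.scaling _ _ _ _ hu hv) k
  have hf₁ := realPart_of_eq_rescale hf
  have hf₂ := imaginaryPart_of_eq_rescale hf
  have hg₁ := realPart_of_eq_rescale hg
  have hg₂ := imaginaryPart_of_eq_rescale hg
  ext k
  simp only [rescale, complexProd_apply, hscale k hf₁ hg₁, hscale k hf₁ hg₂, hscale k hf₂ hg₁,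
    hscale k hf₂ hg₂]

end ComplexProd

section TriadCoeff

variable {op : latticeFn lam → latticeFn lam → latticeFn lam} (hop : IsScaleInvariantProduct op)

/-- The structure constants of the product in the basis of delta functions, with the third index
lowered by `pairing` so that they are symmetric in all three. -/
noncomputable def triadCoeff (x y z : logLattice lam) : ℂ :=
  pairing (hop.complexProd (single x) (single y)) (single z)

theorem complexProd_single_apply (x y z : logLattice lam) :
    (hop.complexProd (single x) (single y)).1 z = hop.triadCoeff x y (-z) := by
  rw [triadCoeff, pairing_single, neg_neg]

theorem triadCoeff_swap (x y z : logLattice lam) :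
    hop.triadCoeff x y z = hop.triadCoeff y x z := by
  rw [triadCoeff, complexProd_comm, triadCoeff]

theorem triadCoeff_rotate (x y z : logLattice lam) :
    hop.triadCoeff x y z = hop.triadCoeff y z x := by
  rw [triadCoeff, pairing_complexProd, pairing_comm, triadCoeff]

theorem triadCoeff_neg (x y z : logLattice lam) :
    hop.triadCoeff (-x) (-y) (-z) = starRingEnd ℂ (hop.triadCoeff x y z) := by
  rw [triadCoeff, ← star_single, ← star_single, complexProd_star, pairing_single, star_apply,
    neg_neg, triadCoeff, pairing_single]

theorem triadCoeff_eq_zero {x y z : logLattice lam} (h : (x : ℝ) + y + z ≠ 0) :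
    hop.triadCoeff x y z = 0 := by
  have hpartial : ∀ p : logLattice lam,
      ((Complex.I * (p : ℝ)) • single p).1 = partialD (single p).1 := fun p => by
    ext l
    by_cases hl : l = p
    · simp [coe_single, partialD, hl]
    · simp [coe_single, partialD, delta_of_ne hl]
  have hleib := congrFun (hop.complexProd_leibniz (hpartial x) (hpartial y)) (-z)
  simp only [map_smul, LinearMap.smul_apply, partialD, Pi.add_apply, Submodule.coe_smul,
    Pi.smul_apply, smul_eq_mul, complexProd_single_apply, neg_neg, coe_neg] at hleib
  push_cast at hleib
  have hprod : Complex.I * ((x + y + z : ℝ) * hop.triadCoeff x y z) = 0 := by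
    push_cast
    linear_combination -hleib
  simpa only [mul_eq_zero, Complex.I_ne_zero, Complex.ofReal_eq_zero, h, false_or] using hprod

theorem triadCoeff_pt_mul (h : 0 < lam) (n : ℤ) (x y z : logLattice lam) :
    hop.triadCoeff (pt lam n * x) (pt lam n * y) (pt lam n * z) = hop.triadCoeff x y z := by
  have hrescale : ∀ p : logLattice lam,
      (single p).1 = rescale (single (pt lam 1 * p)).1 := fun p => by
    ext l
    simp [coe_single, rescale, delta, Subtype.ext_iff, h.ne']
  have hone : ∀ x y z : logLattice lam,
      hop.triadCoeff (pt lam 1 * x) (pt lam 1 * y) (pt lam 1 * z) = hop.triadCoeff x y z :=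
    fun x y z => by
      have hz := congrFun (hop.complexProd_rescale (hrescale x) (hrescale y)) (-z)
      simpa only [rescale, complexProd_single_apply, mul_neg, neg_neg] using hz
  have hsucc : ∀ (n : ℤ) (p : logLattice lam), pt lam (n + 1) * p = pt lam 1 * (pt lam n * p) :=
    fun n p => Subtype.ext (by rw [add_comm, pt_add h.ne', coe_mul, coe_mul, mul_assoc]; rfl)
  induction n using Int.induction_on with
  | zero =>
    have hzero : ∀ p : logLattice lam, pt lam 0 * p = p := fun p => Subtype.ext (by simp)
    rw [hzero, hzero, hzero]
  | succ n ih => rw [hsucc, hsucc, hsucc, hone, ih]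
  | pred n ih => rw [← ih, ← hone, ← hsucc, ← hsucc, ← hsucc, sub_add_cancel]

theorem exists_complexProd_single_ne_zero {f g : summableFn lam} (h : hop.complexProd f g ≠ 0) :
    ∃ z, hop.complexProd g (single z) ≠ 0 := by
  contrapose! h
  ext k
  have hpair := hop.pairing_complexProd f g (single (-k))
  rwa [h, map_zero, pairing_single, neg_neg] at hpair

theorem exists_triadCoeff_ne_zero (h : ∃ f g, op f g ≠ 0) :
    ∃ x y z, hop.triadCoeff x y z ≠ 0 := by
  obtain ⟨f, g, hfg⟩ := h
  have hcomplex : hop.complexProd (selfAdjointEquiv f).1 (selfAdjointEquiv g).1 ≠ 0 := by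
    rw [complexProd_selfAdjointEquiv]
    simpa using hfg
  obtain ⟨x, hx⟩ := hop.exists_complexProd_single_ne_zero hcomplex
  obtain ⟨y, hy⟩ := hop.exists_complexProd_single_ne_zero hx
  contrapose! hy
  ext z
  rw [complexProd_single_apply, hy]
  rfl

end TriadCoeff

section Normalization

variable {op : latticeFn lam → latticeFn lam → latticeFn lam} (hop : IsScaleInvariantProduct op)

theorem add_add_eq_zero_of_triadCoeff_ne_zero {x y z : logLattice lam}
    (h : hop.triadCoeff x y z ≠ 0) : (x : ℝ) + y + z = 0 :=
  not_imp_comm.1 hop.triadCoeff_eq_zero h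

theorem exists_triadCoeff_pt_neg_pt_ne_zero (hlam : 0 < lam) {x y z : logLattice lam}
    (h : hop.triadCoeff x y z ≠ 0) :
    ∃ l m n : ℤ, hop.triadCoeff (pt lam l) (-pt lam m) (-pt lam n) ≠ 0 := by
  have hsum := hop.add_add_eq_zero_of_triadCoeff_ne_zero h
  have hneg := (map_ne_zero (starRingEnd ℂ)).2 h
  rw [← triadCoeff_neg] at hneg
  obtain ⟨l, rfl | rfl⟩ := exists_eq_pt_or_eq_neg_pt x <;>
    obtain ⟨m, rfl | rfl⟩ := exists_eq_pt_or_eq_neg_pt y <;>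
    obtain ⟨n, rfl | rfl⟩ := exists_eq_pt_or_eq_neg_pt z <;>
    simp only [coe_neg, coe_pt, neg_neg] at hsum hneg
  · linarith [zpow_pos hlam l, zpow_pos hlam m, zpow_pos hlam n]
  · exact ⟨n, l, m, by rwa [triadCoeff_rotate]⟩
  · exact ⟨m, n, l, by rwa [← triadCoeff_rotate]⟩
  · exact ⟨l, m, n, h⟩
  · exact ⟨l, m, n, hneg⟩
  · exact ⟨m, n, l, by rwa [← triadCoeff_rotate]⟩
  · exact ⟨n, l, m, by rwa [triadCoeff_rotate]⟩
  · linarith [zpow_pos hlam l, zpow_pos hlam m, zpow_pos hlam n]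

theorem exists_triadCoeff_nat_ne_zero (hlam : 1 < lam) {l m n : ℤ}
    (h : hop.triadCoeff (pt lam l) (-pt lam m) (-pt lam n) ≠ 0) :
    ∃ a b : ℕ, hop.triadCoeff (pt lam b) (-pt lam a) (-pt lam 0) ≠ 0 := by
  have h0 : 0 < lam := one_pos.trans hlam
  wlog hnm : n ≤ m generalizing m n
  · exact this (by rwa [triadCoeff_swap, triadCoeff_rotate]) (le_of_not_ge hnm)
  have hsum := hop.add_add_eq_zero_of_triadCoeff_ne_zero h
  simp only [coe_neg, coe_pt] at hsum
  have hml : m < l := (zpow_lt_zpow_iff_right₀ hlam).1 (by linarith [zpow_pos h0 n])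
  obtain ⟨a, ha⟩ := Int.eq_ofNat_of_zero_le (sub_nonneg.2 hnm)
  obtain ⟨b, hb⟩ := Int.eq_ofNat_of_zero_le (sub_nonneg.2 (hnm.trans hml.le))
  refine ⟨a, b, ?_⟩
  rwa [← hop.triadCoeff_pt_mul h0 n, mul_neg, mul_neg, ← pt_add h0.ne', ← pt_add h0.ne',
    ← pt_add h0.ne', ← ha, ← hb, add_sub_cancel, add_sub_cancel, add_zero]

theorem complexProd_single {x y z : logLattice lam} (h : (z : ℝ) = x + y) :
    hop.complexProd (single x) (single y) = hop.triadCoeff x y (-z) • single z := by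
  ext l
  rw [complexProd_single_apply, Submodule.coe_smul, Pi.smul_apply, coe_single]
  by_cases hl : l = z
  · rw [hl, delta_self, smul_eq_mul, mul_one]
  · rw [delta_of_ne hl, smul_zero, hop.triadCoeff_eq_zero]
    rw [coe_neg, ← h]
    exact fun h' => hl (Subtype.ext (by linarith))

theorem hasTriadCoeff (hlam : 0 < lam) {a b : ℕ} (hab : 1 = lam ^ b - lam ^ a) :
    HasTriadCoeff single hop.complexProd a b
      (hop.triadCoeff (pt lam b) (-pt lam a) (-pt lam 0)) where
  apply_triad n := by
    rw [← hop.triadCoeff_pt_mul hlam n, mul_neg, mul_neg, ← pt_add hlam.ne', ← pt_add hlam.ne',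
      ← pt_add hlam.ne', add_zero, add_comm (b : ℤ), add_comm (a : ℤ)]
    refine hop.complexProd_single ?_
    simp only [coe_neg, coe_pt, zpow_add₀ hlam.ne', zpow_natCast]
    linear_combination lam ^ n * hab
  apply_eq_zero p q hpq := by
    ext l
    rw [complexProd_single_apply, hop.triadCoeff_eq_zero]
    · rfl
    · rw [coe_neg, ← sub_eq_add_neg, sub_ne_zero]
      exact fun h => hpq (h ▸ l.2)

end Normalization

theorem exists_not_associative {op : latticeFn lam → latticeFn lam → latticeFn lam}
    (hop : IsScaleInvariantProduct op) (hlam : 1 < lam) (hne : ∃ f g, op f g ≠ 0) :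
    ∃ f g h, op (op f g) h ≠ op f (op g h) := by
  have h0 : 0 < lam := one_pos.trans hlam
  obtain ⟨x, y, z, hxyz⟩ := hop.exists_triadCoeff_ne_zero hne
  obtain ⟨l, m, n, hlmn⟩ := hop.exists_triadCoeff_pt_neg_pt_ne_zero h0 hxyz
  obtain ⟨a, b, hc⟩ := hop.exists_triadCoeff_nat_ne_zero hlam hlmn
  have hab : 1 = lam ^ b - lam ^ a := by
    have hsum := hop.add_add_eq_zero_of_triadCoeff_ne_zero hc
    simp only [coe_neg, coe_pt, zpow_natCast, zpow_zero] at hsum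
    linarith
  by_contra! hassoc
  exact (hop.hasTriadCoeff h0 hab).not_associative h0 hc (single_ne_zero _)
    (one_add_pow_notMem hlam hab) (hop.complexProd_assoc hassoc _ _ _)

end IsScaleInvariantProduct

end LogLattice

open LogLattice in
theorem corollary1_general {lam : ℝ} (hlam : 1 < lam) :
    (∀ op : latticeFn lam → latticeFn lam → latticeFn lam, IsScaleInvariantProduct op →
      (∃ f g, op f g ≠ 0) → ∃ f g h, op (op f g) h ≠ op f (op g h)) ∧
    (lam = 2 → ∀ c : ℝ, c ≠ 0 →
      NotAssociative (prodDyadic lam c) ∧ DeltaWitness 0 1 (prodDyadic lam c)) ∧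
    (lam = plastic → ∀ c₁ c₂ : ℝ, (c₁ ≠ 0 ∨ c₂ ≠ 0) →
      NotAssociative (prodPlastic lam c₁ c₂) ∧
      (c₁ ≠ 0 → DeltaWitness 1 3 (prodPlastic lam c₁ c₂)) ∧
      (c₂ ≠ 0 → DeltaWitness 4 5 (prodPlastic lam c₁ c₂))) ∧
    (∀ a b : ℕ, 1 = lam ^ b - lam ^ a → ∀ c : ℝ, c ≠ 0 →
      NotAssociative (prodTrinomial lam a b c) ∧ DeltaWitness a b (prodTrinomial lam a b c)) := by
  refine ⟨fun _ hop => hop.exists_not_associative hlam, ?_, ?_, ?_⟩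
  · rintro rfl c hc
    exact prodDyadic_witness hc
  · rintro rfl c₁ c₂ hc
    exact prodPlastic_witness hlam plastic_pow_three hc
  · intro a b hab c hc
    exact prodTrinomial_witness hlam hab hc

theorem corollary1 (lam : ℝ) (hlam : 1 < lam) :
    ((lam = 2 ∨ lam = LogLattice.plastic ∨ ∃ a b : ℕ, LogLattice.IsTrinomialSpacing lam a b) →
      ∀ op : LogLattice.latticeFn lam → LogLattice.latticeFn lam → LogLattice.latticeFn lam,
        LogLattice.IsSymmetricProduct op → (∃ f g, op f g ≠ 0) →
          ∃ f g h, op (op f g) h ≠ op f (op g h)) ∧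
    (lam = 2 → ∀ c : ℝ, c ≠ 0 →
      LogLattice.NotAssociative (LogLattice.prodDyadic lam c) ∧
      LogLattice.DeltaWitness 0 1 (LogLattice.prodDyadic lam c)) ∧
    (lam = LogLattice.plastic → ∀ c₁ c₂ : ℝ, (c₁ ≠ 0 ∨ c₂ ≠ 0) →
      LogLattice.NotAssociative (LogLattice.prodPlastic lam c₁ c₂) ∧
      (c₁ ≠ 0 → LogLattice.DeltaWitness 1 3 (LogLattice.prodPlastic lam c₁ c₂)) ∧
      (c₂ ≠ 0 → LogLattice.DeltaWitness 4 5 (LogLattice.prodPlastic lam c₁ c₂))) ∧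
    (∀ a b : ℕ, LogLattice.IsTrinomialSpacing lam a b → ∀ c : ℝ, c ≠ 0 →
      LogLattice.NotAssociative (LogLattice.prodTrinomial lam a b c) ∧
      LogLattice.DeltaWitness a b (LogLattice.prodTrinomial lam a b c)) := by
  obtain ⟨hop, hd, hp, ht⟩ := corollary1_general hlam
  exact ⟨fun _ op h => hop op h.isScaleInvariantProduct, hd, hp, fun a b h => ht a b h.2.2.2.2.2.2⟩
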